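/- Let $\mathfrak H$ be a (real or complex) Hilbert space with inner product $(\cdot,\cdot)$. A linear operator $a$ in $\mathfrak H$ with domain $\mathrm{dom}\,a$ (a linear subspace) is called positive symmetric if $(ax,y)=(x,ay)$ and $(ax,x)\ge 0$ for all $x,y\in\mathrm{dom}\,a$. If $\mathrm{dom}\,a$ is dense, then $\langle ax,ay\rangle=(ax,y)$ is an inner product on $\mathrm{ran}\,a$, and $\mathfrak H_a$ denotes the Hilbert space obtained by completing $\mathrm{ran}\,a$ for it. The Friedrichs extension $a_{\mathsf F}$ of a densely defined positive symmetric operator $a$ is the restriction of $a^\ast$ to those $y\in\mathrm{dom}\,a^\ast$ for which there are $y_n\in\mathrm{dom}\,a$ with $y_n\to y$ and $(a(y_n-y_m),y_n-y_m)\to0$ as $n,m\to\infty$; it is the largest positive selfadjoint extension of $a$ in the usual (form) ordering, where $A\le B$ means that $\mathrm{dom}\,t_B\subseteq\mathrm{dom}\,t_A$ and $t_A[y]\le t_B[y]$ for all $y\in\mathrm{dom}\,t_B$, with $t_A$, $t_B$ the closures of the forms $x\mapsto(Ax,x)$ on $\mathrm{dom}\,A$ and $x\mapsto(Bx,x)$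 on $\mathrm{dom}\,B$. **Theorem.** Let $a$ and $b$ be positive symmetric operators in $\mathfrak H$ such that $\mathrm{dom}\,a\cap\mathrm{dom}\,b$ is dense in $\mathfrak H$. Let $Q:\mathfrak H\to\mathfrak H_a\oplus\mathfrak H_b$ be the operator with $\mathrm{dom}\,Q=\mathrm{dom}\,a\cap\mathrm{dom}\,b$ and $Qx=ax\oplus bx$, and let $a+b$ be the operator sum, defined on $\mathrm{dom}\,a\cap\mathrm{dom}\,b$. Then $Q^\ast$ is densely defined (so that $Q^{\ast\ast}$ exists), and $$Q^\ast Q^{\ast\ast}=(a+b)_{\mathsf F},$$ where the product on the left has its natural domain $\{x\in\mathrm{dom}\,Q^{\ast\ast}: Q^{\ast\ast}x\in\mathrm{dom}\,Q^\ast\}$. In particular, $Q^\ast Q^{\ast\ast}$ is the largest positive selfadjoint extension of $a+b$. -/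

import Mathlib

open Filter Topology
open scoped LinearPMap

noncomputable section

/-- A (not necessarily densely defined) operator `a` in `H` is symmetric and positive:
`(ax, y) = (x, ay)` and `(ax, x) ≥ 0` for all `x, y ∈ dom a`. -/
structure IsPositiveSymmetric {𝕜 H : Type*} [RCLike 𝕜] [NormedAddCommGroup H]
    [InnerProductSpace 𝕜 H] (a : H →ₗ.[𝕜] H) : Prop where
  symm : ∀ x y : a.domain, inner 𝕜 (a x) (y : H) = inner 𝕜 (x : H) (a y)
  nonneg : ∀ x : a.domain, 0 ≤ RCLike.re (inner 𝕜 (a x) (x : H))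

section Basic

variable {𝕜 H : Type*} [RCLike 𝕜] [NormedAddCommGroup H] [InnerProductSpace 𝕜 H]

theorem IsPositiveSymmetric.add {a b : H →ₗ.[𝕜] H} (ha : IsPositiveSymmetric a)
    (hb : IsPositiveSymmetric b) : IsPositiveSymmetric (a + b) where
  symm x y := by
    rw [LinearPMap.add_apply, LinearPMap.add_apply, inner_add_left, inner_add_right]
    exact congrArg₂ (· + ·) (ha.symm ⟨x, x.2.1⟩ ⟨y, y.2.1⟩) (hb.symm ⟨x, x.2.2⟩ ⟨y, y.2.2⟩)
  nonneg x := by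
    rw [LinearPMap.add_apply, inner_add_left, map_add]
    exact add_nonneg (ha.nonneg ⟨x, x.2.1⟩) (hb.nonneg ⟨x, x.2.2⟩)

/-! ### The Hilbert space `H_a` -/

/-- The range `ran a` of a positive symmetric operator, as a type of its own: it carries the inner
product `⟨ax, ay⟩ = (ax, y)` and not the one inherited from `H`. -/
def RanSpace (a : H →ₗ.[𝕜] H) (_ha : IsPositiveSymmetric a) : Type _ :=
  LinearMap.range a.toFun

namespace RanSpace

variable (a : H →ₗ.[𝕜] H) (ha : IsPositiveSymmetric a)

instance : AddCommGroup (RanSpace a ha) :=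
  inferInstanceAs (AddCommGroup (LinearMap.range a.toFun))

instance : Module 𝕜 (RanSpace a ha) :=
  inferInstanceAs (Module 𝕜 (LinearMap.range a.toFun))

/-- The vector `ax` as an element of `ran a`. -/
def mk : a.domain →ₗ[𝕜] RanSpace a ha := a.toFun.rangeRestrict

/-- The inclusion of `ran a` in `H`. -/
def val : RanSpace a ha →ₗ[𝕜] H := (LinearMap.range a.toFun).subtype

variable {a}

theorem val_mk (x : a.domain) : val a ha (mk a ha x) = a x := rfl

theorem mk_surjective : Function.Surjective (mk a ha) :=
  a.toFun.surjective_rangeRestrict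

/-- Some `x` with `ax = v`. -/
def preimage (v : RanSpace a ha) : a.domain := (mk_surjective ha v).choose

theorem mk_preimage (v : RanSpace a ha) : mk a ha (preimage ha v) = v :=
  (mk_surjective ha v).choose_spec

theorem apply_preimage (v : RanSpace a ha) : a (preimage ha v) = val a ha v := by
  rw [← val_mk ha, mk_preimage]

/-- `(u, y)` does not depend on the choice of `y` with `ay = v`. -/
theorem inner_preimage_mk (u : RanSpace a ha) (y : a.domain) :
    inner 𝕜 (val a ha u) (preimage ha (mk a ha y) : H) = inner 𝕜 (val a ha u) (y : H) := by
  rw [← apply_preimage ha u, ha.symm, ha.symm, apply_preimage, val_mk]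

/-- The form `⟨ax, ay⟩ = (ax, y)` on `ran a`. It is an inner product as soon as `dom a` is dense;
in general it is only positive semidefinite. -/
instance core : PreInnerProductSpace.Core 𝕜 (RanSpace a ha) where
  inner u v := inner 𝕜 (val a ha u) (preimage ha v : H)
  conj_inner_symm u v := by
    rw [inner_conj_symm, ← apply_preimage ha v, ← ha.symm, apply_preimage]
  re_inner_nonneg u := by
    rw [← apply_preimage ha u]
    exact ha.nonneg _
  add_left u v w := by rw [map_add, inner_add_left]
  smul_left u v r := by rw [map_smul, inner_smul_left]

instance : SeminormedAddCommGroup (RanSpace a ha) :=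
  InnerProductSpace.Core.toSeminormedAddCommGroup (𝕜 := 𝕜)

instance : InnerProductSpace 𝕜 (RanSpace a ha) :=
  InnerProductSpace.ofCore (core ha)

theorem inner_mk_mk (x y : a.domain) :
    inner 𝕜 (mk a ha x) (mk a ha y) = inner 𝕜 (a x) (y : H) :=
  inner_preimage_mk ha (mk a ha x) y

/-- If `dom a` is dense, the form `⟨ax, ay⟩ = (ax, y)` on `ran a` is positive definite. -/
theorem definite (hd : Dense (a.domain : Set H)) (u : RanSpace a ha)
    (hu : inner 𝕜 u u = 0) : u = 0 := by
  have h1 : ‖u‖ = 0 := by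
    have h := norm_sq_eq_re_inner (𝕜 := 𝕜) u
    rw [hu] at h
    simpa using h
  have h2 : val a ha u = 0 := by
    apply hd.eq_zero_of_inner_left 𝕜
    intro y hy
    have h := norm_inner_le_norm (𝕜 := 𝕜) u (mk a ha ⟨y, hy⟩)
    rw [h1, zero_mul] at h
    rw [← norm_le_zero_iff.1 h]
    exact (inner_preimage_mk ha u ⟨y, hy⟩).symm
  exact Subtype.ext h2

end RanSpace

/-- The Hilbert space `H_a`: the completion of `ran a` for `⟨ax, ay⟩ = (ax, y)`. -/
abbrev EnergySpace (a : H →ₗ.[𝕜] H) (ha : IsPositiveSymmetric a) : Type _ :=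
  UniformSpace.Completion (RanSpace a ha)

/-- The vector `ax` as an element of `H_a`, for `x ∈ dom a`. -/
def EnergySpace.mk (a : H →ₗ.[𝕜] H) (ha : IsPositiveSymmetric a) :
    a.domain →ₗ[𝕜] EnergySpace a ha :=
  (UniformSpace.Completion.toComplₗᵢ (𝕜 := 𝕜) (E := RanSpace a ha)).toLinearMap ∘ₗ
    RanSpace.mk a ha

theorem EnergySpace.inner_mk_mk (a : H →ₗ.[𝕜] H) (ha : IsPositiveSymmetric a) (x y : a.domain) :
    inner 𝕜 (EnergySpace.mk a ha x) (EnergySpace.mk a ha y) = inner 𝕜 (a x) (y : H) :=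
  (UniformSpace.Completion.inner_coe _ _).trans (RanSpace.inner_mk_mk ha x y)

/-- The operator `Q : H → H_a ⊕ H_b` with `dom Q = dom a ∩ dom b` and `Qx = ax ⊕ bx`, where
`H_a ⊕ H_b` is the Hilbert space direct sum. -/
def sumQ (a b : H →ₗ.[𝕜] H) (ha : IsPositiveSymmetric a) (hb : IsPositiveSymmetric b) :
    H →ₗ.[𝕜] WithLp 2 (EnergySpace a ha × EnergySpace b hb) where
  domain := a.domain ⊓ b.domain
  toFun := (WithLp.linearEquiv 2 𝕜 (EnergySpace a ha × EnergySpace b hb)).symm.toLinearMap ∘ₗ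
    ((EnergySpace.mk a ha ∘ₗ Submodule.inclusion inf_le_left).prod
      (EnergySpace.mk b hb ∘ₗ Submodule.inclusion inf_le_right))

theorem sumQ_apply (a b : H →ₗ.[𝕜] H) (ha : IsPositiveSymmetric a) (hb : IsPositiveSymmetric b)
    (x : H) (hxa : x ∈ a.domain) (hxb : x ∈ b.domain) :
    sumQ a b ha hb ⟨x, hxa, hxb⟩ =
      WithLp.toLp 2 (EnergySpace.mk a ha ⟨x, hxa⟩, EnergySpace.mk b hb ⟨x, hxb⟩) := rfl

end Basic

/-! ### Products of unbounded operators -/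

/-- The product `g f` of two unbounded operators, on its natural domain
`{x ∈ dom f : f x ∈ dom g}`. -/
def opMul {𝕜 E F G : Type*} [RCLike 𝕜] [AddCommGroup E] [Module 𝕜 E] [AddCommGroup F]
    [Module 𝕜 F] [AddCommGroup G] [Module 𝕜 G] (g : F →ₗ.[𝕜] G) (f : E →ₗ.[𝕜] F) :
    E →ₗ.[𝕜] G where
  domain := (g.domain.comap f.toFun).map f.domain.subtype
  toFun := g.toFun ∘ₗ (f.toFun.restrict (p := g.domain.comap f.toFun) (q := g.domain)
      fun _ hx => hx) ∘ₗ
    (f.domain.equivSubtypeMap (g.domain.comap f.toFun)).symm.toLinearMap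

theorem mem_opMul_domain {𝕜 E F G : Type*} [RCLike 𝕜] [AddCommGroup E] [Module 𝕜 E]
    [AddCommGroup F] [Module 𝕜 F] [AddCommGroup G] [Module 𝕜 G] (g : F →ₗ.[𝕜] G)
    (f : E →ₗ.[𝕜] F) (x : E) :
    x ∈ (opMul g f).domain ↔ ∃ hx : x ∈ f.domain, f ⟨x, hx⟩ ∈ g.domain := by
  constructor
  · rintro ⟨y, hy, rfl⟩
    exact ⟨y.2, hy⟩
  · rintro ⟨hx, hy⟩
    exact ⟨⟨x, hx⟩, hy, rfl⟩

theorem opMul_apply {𝕜 E F G : Type*} [RCLike 𝕜] [AddCommGroup E] [Module 𝕜 E]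
    [AddCommGroup F] [Module 𝕜 F] [AddCommGroup G] [Module 𝕜 G] (g : F →ₗ.[𝕜] G)
    (f : E →ₗ.[𝕜] F) (x : E) (h : x ∈ (opMul g f).domain) (hx : x ∈ f.domain)
    (hy : f ⟨x, hx⟩ ∈ g.domain) : opMul g f ⟨x, h⟩ = g ⟨f ⟨x, hx⟩, hy⟩ := rfl

/-! ### Closure of the form of a positive symmetric operator, Friedrichs extension -/

section Friedrichs

variable {𝕜 H : Type*} [RCLike 𝕜] [NormedAddCommGroup H] [InnerProductSpace 𝕜 H]

/-- The sequence `u` in `dom a` converges to `y` in `H` and is Cauchy for the quadratic form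
`x ↦ (ax, x)`. -/
def IsFormApprox (a : H →ₗ.[𝕜] H) (u : ℕ → a.domain) (y : H) : Prop :=
  Tendsto (fun n => (u n : H)) atTop (𝓝 y) ∧
  Tendsto (fun p : ℕ × ℕ => RCLike.re (inner 𝕜 (a (u p.1 - u p.2)) ((u p.1 - u p.2 : a.domain) : H)))
    atTop (𝓝 0)

/-- `y` lies in the domain of the closure of the form `x ↦ (ax, x)`, and the closure has the value
`r` at `y`. For a positive selfadjoint `a` this means `y ∈ dom a^{1/2}` and `r = ‖a^{1/2} y‖²`. -/
def HasFormValue (a : H →ₗ.[𝕜] H) (y : H) (r : ℝ) : Prop :=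
  ∃ u : ℕ → a.domain, IsFormApprox a u y ∧
    Tendsto (fun n => RCLike.re (inner 𝕜 (a (u n)) (u n : H))) atTop (𝓝 r)

/-- The usual ordering `A ≤ B` of positive selfadjoint operators: the closed form of `B` has the
smaller domain, and there the form of `A` is at most the form of `B`. -/
def FormLE (A B : H →ₗ.[𝕜] H) : Prop :=
  ∀ (y : H) (r : ℝ), HasFormValue B y r → ∃ r' ≤ r, HasFormValue A y r'

/-- `A` is a positive selfadjoint extension of `a`. -/
structure IsPositiveSelfAdjointExtension [CompleteSpace H] (a A : H →ₗ.[𝕜] H) : Prop where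
  le : a ≤ A
  selfAdjoint : IsSelfAdjoint A
  nonneg : ∀ x : A.domain, 0 ≤ RCLike.re (inner 𝕜 (A x) (x : H))

/-- `A` is the largest positive selfadjoint extension of `a`. -/
def IsLargestPositiveSelfAdjointExtension [CompleteSpace H] (a A : H →ₗ.[𝕜] H) : Prop :=
  IsPositiveSelfAdjointExtension a A ∧
    ∀ B : H →ₗ.[𝕜] H, IsPositiveSelfAdjointExtension a B → FormLE B A

theorem IsPositiveSymmetric.form_add_le {a : H →ₗ.[𝕜] H} (ha : IsPositiveSymmetric a)
    (x y : a.domain) :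
    RCLike.re (inner 𝕜 (a (x + y)) ((x + y : a.domain) : H)) ≤
      2 * RCLike.re (inner 𝕜 (a x) (x : H)) + 2 * RCLike.re (inner 𝕜 (a y) (y : H)) := by
  have h := ha.nonneg (x - y)
  rw [LinearPMap.map_sub, Submodule.coe_sub] at h
  rw [LinearPMap.map_add, Submodule.coe_add]
  simp only [inner_add_left, inner_add_right, inner_sub_left, inner_sub_right, map_add,
    map_sub] at h ⊢
  linarith

/-- The domain of the closure of the form `x ↦ (ax, x)`. -/
def closedFormDomain (a : H →ₗ.[𝕜] H) (ha : IsPositiveSymmetric a) : Submodule 𝕜 H where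
  carrier := {y | ∃ u : ℕ → a.domain, IsFormApprox a u y}
  zero_mem' := ⟨fun _ => 0, by simp [IsFormApprox]⟩
  add_mem' := by
    rintro y z ⟨u, hu, hu'⟩ ⟨v, hv, hv'⟩
    refine ⟨fun n => u n + v n, by simpa using hu.add hv, ?_⟩
    refine squeeze_zero (fun p => ha.nonneg _) (fun p => ?_)
      (by simpa using (hu'.const_mul 2).add (hv'.const_mul 2))
    have h : u p.1 + v p.1 - (u p.2 + v p.2) = (u p.1 - u p.2) + (v p.1 - v p.2) := by abel
    simp only [h]
    exact ha.form_add_le _ _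
  smul_mem' := by
    rintro c y ⟨u, hu, hu'⟩
    refine ⟨fun n => c • u n, by simpa using hu.const_smul c, ?_⟩
    have h := hu'.const_mul (‖c‖ ^ 2)
    rw [mul_zero] at h
    refine h.congr fun p => ?_
    rw [← smul_sub, LinearPMap.map_smul, Submodule.coe_smul, inner_smul_left, inner_smul_right,
      ← mul_assoc, RCLike.conj_mul, ← RCLike.ofReal_pow, RCLike.re_ofReal_mul]

/-- The Friedrichs extension `a_F` of a densely defined positive symmetric operator `a`: the
restriction of `a*` to the vectors of `dom a*` that lie in the domain of the closure of the form
of `a`. -/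
def friedrichsExtension [CompleteSpace H] (a : H →ₗ.[𝕜] H) (ha : IsPositiveSymmetric a) :
    H →ₗ.[𝕜] H :=
  a†.domRestrict (closedFormDomain a ha)

end Friedrichs

end

/-! The form of `a + b` factors through Q: (Qx, Qy) = ((a + b)x, y). Every ax ⊕ by, with x ∈ dom a
and y ∈ dom b chosen independently, lies in dom Q*, and Q* sends it to ax + by. Such vectors are
dense, so Q** exists and its graph is the closure of the graph of Q. The rest holds for any positive
symmetric, densely defined c with (Lx, Ly) = (cx, y), where T is L viewed as an operator with T*
densely defined. Form-Cauchy sequences are those along which L is Cauchy, so dom T** is the domain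
of the closed form. By von Neumann's theorem T*T** is a selfadjoint extension of c, and passing to
limits in the factorization identifies it with the Friedrichs extension
(`opMul_adjoint_eq_friedrichsExtension`). It is the largest because its closed form is already
approximated on dom c, where all extensions agree. -/

section AdjointGraph

/-! ### Graphs of adjoints and von Neumann's theorem -/

variable {𝕜 E F : Type*} [RCLike 𝕜] [NormedAddCommGroup E] [InnerProductSpace 𝕜 E]
  [NormedAddCommGroup F] [InnerProductSpace 𝕜 F] [CompleteSpace E]

theorem mem_graph_adjoint_iff {T : E →ₗ.[𝕜] F} (hT : Dense (T.domain : Set E)) (y : F) (w : E) :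
    (y, w) ∈ T†.graph ↔ ∀ x : T.domain, inner 𝕜 w (x : E) = inner 𝕜 y (T x) := by
  rw [LinearPMap.mem_graph_iff]
  constructor
  · rintro ⟨v, hv, hw⟩ x
    have h := LinearPMap.adjoint_isFormalAdjoint hT v x
    rwa [hv, hw] at h
  · intro h
    exact ⟨⟨y, LinearPMap.mem_adjoint_domain_of_exists y ⟨w, h⟩⟩, rfl,
      LinearPMap.adjoint_apply_eq hT _ h⟩

variable [CompleteSpace F]

theorem le_adjoint_adjoint {T : E →ₗ.[𝕜] F} (hT : Dense (T.domain : Set E))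
    (hT' : Dense (T†.domain : Set F)) : T ≤ T†† :=
  LinearPMap.IsFormalAdjoint.le_adjoint hT' (LinearPMap.adjoint_isFormalAdjoint hT)

/-- The graph of the second adjoint lies in the closure of the graph of the operator. -/
theorem exists_seq_tendsto_of_mem_graph_adjoint_adjoint {T : E →ₗ.[𝕜] F}
    (hT : Dense (T.domain : Set E)) (hT' : Dense (T†.domain : Set F)) {x : E} {y : F}
    (hxy : (x, y) ∈ T††.graph) :
    ∃ u : ℕ → T.domain, Tendsto (fun n => (u n : E)) atTop (𝓝 x) ∧
      Tendsto (fun n => T (u n)) atTop (𝓝 y) := by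
  let G : Submodule 𝕜 (WithLp 2 (E × F)) :=
    T.graph.map (WithLp.linearEquiv 2 𝕜 (E × F)).symm.toLinearMap
  have hG : WithLp.toLp 2 (x, y) ∈ Gᗮᗮ := by
    rw [Submodule.mem_orthogonal']
    intro v hv
    rw [Submodule.mem_orthogonal'] at hv
    -- The orthogonal complement of the graph of T is the graph of T* rotated by a right angle.
    have hadj : (v.snd, -v.fst) ∈ T†.graph := by
      rw [mem_graph_adjoint_iff hT]
      intro z
      have h := hv (WithLp.toLp 2 ((z : E), T z)) ⟨_, T.mem_graph z, rfl⟩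
      rw [WithLp.prod_inner_apply] at h
      rw [inner_neg_left]
      exact (eq_neg_of_add_eq_zero_right h).symm
    obtain ⟨p, hp, hp'⟩ := (LinearPMap.mem_graph_iff _).1 hadj
    have h := (mem_graph_adjoint_iff hT' x y).1 hxy p
    rw [hp, hp', inner_neg_right] at h
    rw [WithLp.prod_inner_apply]
    exact (congrArg (inner 𝕜 x v.fst + ·) h).trans (add_neg_cancel _)
  rw [Submodule.orthogonal_orthogonal_eq_closure, ← SetLike.mem_coe,
    Submodule.topologicalClosure_coe, mem_closure_iff_seq_limit] at hG
  obtain ⟨g, hg, hlim⟩ := hG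
  have hex : ∀ n, ∃ u : T.domain, WithLp.toLp 2 ((u : E), T u) = g n := by
    intro n
    obtain ⟨p, hp, hpg⟩ := hg n
    obtain ⟨u, rfl⟩ := (LinearPMap.mem_graph_iff' _).1 hp
    exact ⟨u, hpg⟩
  choose u hu using hex
  have h := ((WithLp.prod_continuous_ofLp 2 E F).tendsto _).comp hlim
  have hu' : (WithLp.ofLp ∘ g) = fun n => ((u n : E), T (u n)) := by
    funext n
    simp [← hu n]
  rw [hu'] at h
  exact ⟨u, (continuous_fst.tendsto _).comp h, (continuous_snd.tendsto _).comp h⟩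

theorem mem_graph_adjoint_adjoint_of_tendsto {T : E →ₗ.[𝕜] F}
    (hT : Dense (T.domain : Set E)) (hT' : Dense (T†.domain : Set F)) {x : E} {y : F}
    {u : ℕ → T.domain} (hu : Tendsto (fun n => (u n : E)) atTop (𝓝 x))
    (hTu : Tendsto (fun n => T (u n)) atTop (𝓝 y)) : (x, y) ∈ T††.graph :=
  (LinearPMap.adjoint_isClosed hT').mem_of_tendsto (hu.prodMk_nhds hTu)
    (Eventually.of_forall fun n =>
      LinearPMap.le_graph_of_le (le_adjoint_adjoint hT hT') (T.mem_graph (u n)))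

/-- A symmetric operator `A` with dense domain for which `1 + A` is surjective is selfadjoint. -/
theorem isSelfAdjoint_of_add_surjective {A : E →ₗ.[𝕜] E} (hA : Dense (A.domain : Set E))
    (hsymm : A.IsFormalAdjoint A) (hsurj : ∀ h : E, ∃ x : A.domain, (x : E) + A x = h) :
    IsSelfAdjoint A := by
  rw [LinearPMap.isSelfAdjoint_def]
  refine (LinearPMap.eq_of_le_of_domain_eq
    (LinearPMap.IsFormalAdjoint.le_adjoint hA hsymm) (le_antisymm
      (LinearPMap.IsFormalAdjoint.le_adjoint hA hsymm).1 ?_)).symm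
  intro y hy
  -- With (1 + A)x = (1 + A*)y, the vector y - x is killed by 1 + A*, hence orthogonal to the range
  -- of 1 + A, which is everything.
  obtain ⟨x, hx⟩ := hsurj (y + A† ⟨y, hy⟩)
  have h0 : y - x = 0 := by
    obtain ⟨z, hz⟩ := hsurj (y - x)
    rw [← inner_self_eq_zero (𝕜 := 𝕜)]
    have h1 := LinearPMap.adjoint_isFormalAdjoint hA ⟨y, hy⟩ z
    have h2 := hsymm x z
    have h3 : inner 𝕜 ((x : E) + A x) (z : E) = inner 𝕜 (y + A† ⟨y, hy⟩) (z : E) := by rw [hx]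
    calc inner 𝕜 (y - x) (y - x) = inner 𝕜 (y - x) ((z : E) + A z) := by rw [hz]
      _ = 0 := by
        rw [inner_add_right, inner_sub_left, inner_sub_left]
        rw [inner_add_left, inner_add_left] at h3
        linear_combination -h3 - h1 + h2
  rw [sub_eq_zero.1 h0]
  exact x.2

theorem opMul_adjoint_inner {T : E →ₗ.[𝕜] F} (hT' : Dense (T†.domain : Set F))
    (x : (opMul T† T††).domain) (hx : (x : E) ∈ T††.domain) (y : T††.domain) :
    inner 𝕜 (opMul T† T†† x) (y : E) = inner 𝕜 (T†† ⟨x, hx⟩) (T†† y) := by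
  obtain ⟨hx', hTx⟩ := (mem_opMul_domain _ _ _).1 x.2
  rw [show opMul T† T†† x = T† ⟨T†† ⟨x, hx⟩, hTx⟩ from opMul_apply _ _ _ x.2 hx hTx]
  exact (LinearPMap.adjoint_isFormalAdjoint hT').symm ⟨_, hTx⟩ y

/-- A pair in the graph of `T††` whose second entry lies in the domain of `T†`. -/
theorem mem_graph_opMul {T : E →ₗ.[𝕜] F} {x w : E} {y : F} (hxy : (x, y) ∈ T††.graph)
    (hyw : (y, w) ∈ T†.graph) : (x, w) ∈ (opMul T† T††).graph := by
  obtain ⟨p, rfl, rfl⟩ := (LinearPMap.mem_graph_iff _).1 hxy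
  obtain ⟨q, hq, rfl⟩ := (LinearPMap.mem_graph_iff _).1 hyw
  have hp : T†† p ∈ T†.domain := LinearPMap.mem_domain_of_mem_graph hyw
  obtain rfl : q = ⟨T†† p, hp⟩ := Subtype.ext hq
  exact (LinearPMap.mem_graph_iff _).2
    ⟨⟨p, (mem_opMul_domain _ _ _).2 ⟨p.2, hp⟩⟩, rfl, rfl⟩

theorem exists_of_mem_opMul_domain {T : E →ₗ.[𝕜] F} (x : (opMul T† T††).domain) :
    ∃ y : F, ((x : E), y) ∈ T††.graph ∧ (y, opMul T† T†† x) ∈ T†.graph := by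
  obtain ⟨hx, hTx⟩ := (mem_opMul_domain _ _ _).1 x.2
  exact ⟨T†† ⟨x, hx⟩, LinearPMap.mem_graph _ ⟨(x : E), hx⟩, LinearPMap.mem_graph T† ⟨_, hTx⟩⟩

/-- Project (h, 0) onto the closed graph of T**: the projection is (x, T**x), and orthogonality of
the remainder (h - x, -T**x) says T*T**x = h - x. -/
theorem opMul_adjoint_add_surjective {T : E →ₗ.[𝕜] F} (hT : Dense (T.domain : Set E))
    (hT' : Dense (T†.domain : Set F)) (h : E) :
    ∃ x : (opMul T† T††).domain, (x : E) + opMul T† T†† x = h := by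
  let G : Submodule 𝕜 (WithLp 2 (E × F)) :=
    T††.graph.map (WithLp.linearEquiv 2 𝕜 (E × F)).symm.toLinearMap
  have hmem : ∀ p : WithLp 2 (E × F), p ∈ G ↔ WithLp.ofLp p ∈ T††.graph := by
    intro p
    constructor
    · rintro ⟨q, hq, rfl⟩
      exact hq
    · intro hp
      exact ⟨_, hp, rfl⟩
  have hclosed : IsClosed (G : Set (WithLp 2 (E × F))) := by
    have h1 := (LinearPMap.adjoint_isClosed hT').preimage (WithLp.prod_continuous_ofLp 2 E F)
    convert h1 using 1
    ext p
    exact hmem p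
  have : CompleteSpace G := hclosed.completeSpace_coe
  obtain ⟨p, hp, q, hq, hpq⟩ := G.exists_add_mem_mem_orthogonal (WithLp.toLp 2 (h, (0 : F)))
  have hfst : h = p.fst + q.fst := congrArg WithLp.fst hpq
  have hsnd : 0 = p.snd + q.snd := congrArg WithLp.snd hpq
  have hgraph : (p.fst, p.snd) ∈ T††.graph := (hmem p).1 hp
  have hadj : (p.snd, q.fst) ∈ T†.graph := by
    rw [mem_graph_adjoint_iff hT]
    intro z
    rw [Submodule.mem_orthogonal'] at hq
    have h1 := hq (WithLp.toLp 2 ((z : E), T z)) ((hmem _).2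
      (LinearPMap.le_graph_of_le (le_adjoint_adjoint hT hT') (T.mem_graph z)))
    rw [WithLp.prod_inner_apply] at h1
    have h2 : p.snd = -q.snd := eq_neg_of_add_eq_zero_left hsnd.symm
    rw [h2, inner_neg_left]
    exact eq_neg_of_add_eq_zero_left h1
  obtain ⟨x, hx, hx'⟩ := (LinearPMap.mem_graph_iff _).1 (mem_graph_opMul hgraph hadj)
  exact ⟨x, by rw [hx, hx', hfst]⟩

theorem opMul_adjoint_isFormalAdjoint {T : E →ₗ.[𝕜] F} (hT' : Dense (T†.domain : Set F)) :
    (opMul T† T††).IsFormalAdjoint (opMul T† T††) := by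
  intro x y
  obtain ⟨hx, -⟩ := (mem_opMul_domain _ _ _).1 x.2
  obtain ⟨hy, -⟩ := (mem_opMul_domain _ _ _).1 y.2
  rw [opMul_adjoint_inner hT' x hx ⟨y, hy⟩, ← inner_conj_symm (x : E),
    opMul_adjoint_inner hT' y hy ⟨x, hx⟩, inner_conj_symm]

theorem opMul_adjoint_re_inner_self {T : E →ₗ.[𝕜] F} (hT' : Dense (T†.domain : Set F))
    (x : (opMul T† T††).domain) (hx : (x : E) ∈ T††.domain) :
    RCLike.re (inner 𝕜 (opMul T† T†† x) (x : E)) = ‖T†† ⟨x, hx⟩‖ ^ 2 := by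
  rw [opMul_adjoint_inner hT' x hx ⟨x, hx⟩, ← norm_sq_eq_re_inner]

/-- Von Neumann's theorem: `T* T**` is selfadjoint as soon as its domain is dense. -/
theorem isSelfAdjoint_opMul_adjoint {T : E →ₗ.[𝕜] F} (hT : Dense (T.domain : Set E))
    (hT' : Dense (T†.domain : Set F)) (hd : Dense ((opMul T† T††).domain : Set E)) :
    IsSelfAdjoint (opMul T† T††) :=
  isSelfAdjoint_of_add_surjective hd (opMul_adjoint_isFormalAdjoint hT')
    (opMul_adjoint_add_surjective hT hT')

end AdjointGraph

/-! ### Factorized positive symmetric operators -/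

section Factorization

variable {𝕜 H F : Type*} [RCLike 𝕜] [NormedAddCommGroup H] [InnerProductSpace 𝕜 H]
  [NormedAddCommGroup F] [InnerProductSpace 𝕜 F]
  {c : H →ₗ.[𝕜] H} {L : c.domain →ₗ[𝕜] F}

theorem re_inner_self_eq_norm_sq (hL : ∀ x y : c.domain, inner 𝕜 (L x) (L y) = inner 𝕜 (c x) (y : H))
    (x : c.domain) : RCLike.re (inner 𝕜 (c x) (x : H)) = ‖L x‖ ^ 2 := by
  rw [← hL, ← norm_sq_eq_re_inner]

/-- The form at a difference of terms is the squared distance of their images under L. -/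
theorem isFormApprox_iff (hL : ∀ x y : c.domain, inner 𝕜 (L x) (L y) = inner 𝕜 (c x) (y : H))
    (u : ℕ → c.domain) (y : H) :
    IsFormApprox c u y ↔
      Tendsto (fun n => (u n : H)) atTop (𝓝 y) ∧ CauchySeq (fun n => L (u n)) := by
  refine and_congr_right fun _ => ?_
  rw [cauchySeq_iff_tendsto_dist_atTop_0]
  simp only [re_inner_self_eq_norm_sq hL, map_sub, dist_eq_norm]
  constructor
  · intro h
    simpa using h.sqrt
  · intro h
    simpa using h.pow 2

variable [CompleteSpace H] [CompleteSpace F]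

theorem le_opMul_adjoint (hL : ∀ x y : c.domain, inner 𝕜 (L x) (L y) = inner 𝕜 (c x) (y : H))
    (hc : Dense (c.domain : Set H))
    (hT' : Dense ((LinearPMap.mk c.domain L)†.domain : Set F)) :
    c ≤ opMul (LinearPMap.mk c.domain L)† (LinearPMap.mk c.domain L)†† := by
  refine LinearPMap.le_of_le_graph ?_
  rintro ⟨x, w⟩ hxw
  obtain ⟨p, rfl, rfl⟩ := (LinearPMap.mem_graph_iff _).1 hxw
  refine mem_graph_opMul (y := L p) (LinearPMap.le_graph_of_le
    (le_adjoint_adjoint (T := LinearPMap.mk c.domain L) hc hT')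
      ((LinearPMap.mk c.domain L).mem_graph p)) ?_
  exact (mem_graph_adjoint_iff (T := LinearPMap.mk c.domain L) hc _ _).2 fun z => (hL p z).symm

theorem opMul_adjoint_eq_friedrichsExtension
    (hL : ∀ x y : c.domain, inner 𝕜 (L x) (L y) = inner 𝕜 (c x) (y : H))
    (hcs : IsPositiveSymmetric c) (hc : Dense (c.domain : Set H))
    (hT' : Dense ((LinearPMap.mk c.domain L)†.domain : Set F)) :
    opMul (LinearPMap.mk c.domain L)† (LinearPMap.mk c.domain L)†† =
      friedrichsExtension c hcs := by
  set T : H →ₗ.[𝕜] F := LinearPMap.mk c.domain L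
  have hT : Dense (T.domain : Set H) := hc
  refine LinearPMap.eq_of_eq_graph (Submodule.ext ?_)
  rintro ⟨x, w⟩
  constructor
  · intro hxw
    obtain ⟨p, rfl, rfl⟩ := (LinearPMap.mem_graph_iff _).1 hxw
    obtain ⟨y, hpy, hyw⟩ := exists_of_mem_opMul_domain p
    -- T*T** is symmetric and extends c, so it is contained in c*.
    have hcp : ((p : H), opMul T† T†† p) ∈ c†.graph := by
      rw [mem_graph_adjoint_iff hc]
      have hle := le_opMul_adjoint hL hc hT'
      intro z
      have h := opMul_adjoint_isFormalAdjoint hT' p ⟨z, hle.1 z.2⟩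
      rwa [← hle.2 (x := z) (y := ⟨z, hle.1 z.2⟩) rfl] at h
    obtain ⟨u, hu, hTu⟩ := exists_seq_tendsto_of_mem_graph_adjoint_adjoint hT hT' hpy
    have hform : (p : H) ∈ closedFormDomain c hcs :=
      ⟨u, (isFormApprox_iff hL u _).2 ⟨hu, hTu.cauchySeq⟩⟩
    obtain ⟨q, hq, hq'⟩ := (LinearPMap.mem_graph_iff _).1 hcp
    refine (LinearPMap.mem_graph_iff _).2 ⟨⟨p, hform, LinearPMap.mem_domain_of_mem_graph hcp⟩, rfl, ?_⟩
    rw [← hq']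
    exact LinearPMap.domRestrict_apply hq.symm
  · intro hxw
    have hadj : (x, w) ∈ c†.graph := LinearPMap.le_graph_of_le LinearPMap.domRestrict_le hxw
    obtain ⟨p, rfl, -⟩ := (LinearPMap.mem_graph_iff _).1 hxw
    obtain ⟨u, hu⟩ := p.2.1
    obtain ⟨hu, hcauchy⟩ := (isFormApprox_iff hL u _).1 hu
    obtain ⟨y, hy⟩ := cauchySeq_tendsto_of_complete hcauchy
    have hpy := mem_graph_adjoint_adjoint_of_tendsto (T := T) hT hT' hu hy
    -- For z ∈ dom c: (w, z) = (p, cz) = lim (u n, cz) = lim (L(u n), Lz) = (y, Lz), so T*y = w.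
    refine mem_graph_opMul hpy ((mem_graph_adjoint_iff hT _ _).2 fun z => ?_)
    rw [(mem_graph_adjoint_iff hc _ _).1 hadj z]
    have h1 : Tendsto (fun n => inner 𝕜 (L (u n)) (L z)) atTop (𝓝 (inner 𝕜 y (L z))) :=
      hy.inner tendsto_const_nhds
    have h2 : Tendsto (fun n => inner 𝕜 (u n : H) (c z)) atTop (𝓝 (inner 𝕜 (p : H) (c z))) :=
      hu.inner tendsto_const_nhds
    refine tendsto_nhds_unique h2 (h1.congr fun n => ?_)
    rw [hL, hcs.symm]

/-- Makes dom c a form core: both closed forms take the value ‖T**y‖² at y, and the graph of T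
approximates (y, T**y). -/
theorem hasFormValue_of_hasFormValue_opMul_adjoint
    (hL : ∀ x y : c.domain, inner 𝕜 (L x) (L y) = inner 𝕜 (c x) (y : H))
    (hc : Dense (c.domain : Set H))
    (hT' : Dense ((LinearPMap.mk c.domain L)†.domain : Set F)) {y : H} {r : ℝ}
    (h : HasFormValue (opMul (LinearPMap.mk c.domain L)† (LinearPMap.mk c.domain L)††) y r) :
    HasFormValue c y r := by
  set T : H →ₗ.[𝕜] F := LinearPMap.mk c.domain L
  have hT : Dense (T.domain : Set H) := hc
  obtain ⟨v, ⟨hv, hcauchy⟩, hr⟩ := h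
  have hdom : ∀ x : (opMul T† T††).domain, (x : H) ∈ T††.domain := fun x =>
    ((mem_opMul_domain _ _ _).1 x.2).1
  -- S factors T*T** as L factors c, so `isFormApprox_iff` applies to it as well.
  let S : (opMul T† T††).domain →ₗ[𝕜] F := T††.toFun ∘ₗ Submodule.inclusion fun x hx => hdom ⟨x, hx⟩
  have hS : ∀ x y : (opMul T† T††).domain,
      inner 𝕜 (S x) (S y) = inner 𝕜 (opMul T† T†† x) (y : H) := fun x y =>
    (opMul_adjoint_inner hT' x (hdom x) ⟨y, hdom y⟩).symm
  obtain ⟨-, hSc⟩ := (isFormApprox_iff hS v y).1 ⟨hv, hcauchy⟩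
  obtain ⟨z, hz⟩ := cauchySeq_tendsto_of_complete hSc
  have hyz : (y, z) ∈ T††.graph := (LinearPMap.adjoint_isClosed hT').mem_of_tendsto
    (hv.prodMk_nhds hz) (Eventually.of_forall fun n => T††.mem_graph ⟨v n, hdom (v n)⟩)
  obtain ⟨u, hu, hTu⟩ := exists_seq_tendsto_of_mem_graph_adjoint_adjoint hT hT' hyz
  refine ⟨u, (isFormApprox_iff hL u y).2 ⟨hu, hTu.cauchySeq⟩, ?_⟩
  have h1 : Tendsto (fun n => ‖L (u n)‖ ^ 2) atTop (𝓝 (‖z‖ ^ 2)) := hTu.norm.pow 2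
  have h2 : Tendsto (fun n => ‖S (v n)‖ ^ 2) atTop (𝓝 (‖z‖ ^ 2)) := hz.norm.pow 2
  simp only [re_inner_self_eq_norm_sq hS] at hr
  simp only [re_inner_self_eq_norm_sq hL]
  rwa [tendsto_nhds_unique hr h2]

theorem isLargestPositiveSelfAdjointExtension_opMul_adjoint
    (hL : ∀ x y : c.domain, inner 𝕜 (L x) (L y) = inner 𝕜 (c x) (y : H))
    (hc : Dense (c.domain : Set H))
    (hT' : Dense ((LinearPMap.mk c.domain L)†.domain : Set F)) :
    IsLargestPositiveSelfAdjointExtension c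
      (opMul (LinearPMap.mk c.domain L)† (LinearPMap.mk c.domain L)††) := by
  have hle := le_opMul_adjoint hL hc hT'
  refine ⟨⟨hle, isSelfAdjoint_opMul_adjoint (T := LinearPMap.mk c.domain L) hc hT'
    (hc.mono hle.1), fun x => ?_⟩, fun B hB y r hy => ⟨r, le_rfl, ?_⟩⟩
  · rw [opMul_adjoint_re_inner_self hT' x ((mem_opMul_domain _ _ _).1 x.2).1]
    positivity
  -- A sequence in dom c approximating y serves every extension B with the same value r.
  · obtain ⟨u, ⟨hu, hcauchy⟩, hr⟩ := hasFormValue_of_hasFormValue_opMul_adjoint hL hc hT' hy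
    have happ : ∀ x : c.domain, B (Submodule.inclusion hB.le.1 x) = c x := fun x =>
      (hB.le.2 rfl).symm
    refine ⟨fun n => Submodule.inclusion hB.le.1 (u n), ⟨hu, ?_⟩, ?_⟩
    · simp only [← map_sub, happ]
      exact hcauchy
    · simp only [happ]
      exact hr

end Factorization

/-! ### The operator Q and the density of dom Q* -/

section SumQ

variable {𝕜 H : Type*} [RCLike 𝕜] [NormedAddCommGroup H] [InnerProductSpace 𝕜 H]

theorem EnergySpace.denseRange_mk (a : H →ₗ.[𝕜] H) (ha : IsPositiveSymmetric a) :
    DenseRange (EnergySpace.mk a ha) :=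
  UniformSpace.Completion.denseRange_coe.comp (RanSpace.mk_surjective ha).denseRange
    (UniformSpace.Completion.continuous_coe _)

/-- Independent x and y give the density of dom Q*; equal ones give the factorization of `a + b`. -/
theorem inner_sumQ_toLp (a b : H →ₗ.[𝕜] H) (ha : IsPositiveSymmetric a)
    (hb : IsPositiveSymmetric b) (x : a.domain) (y : b.domain) (z : (sumQ a b ha hb).domain) :
    inner 𝕜 (WithLp.toLp 2 (EnergySpace.mk a ha x, EnergySpace.mk b hb y)) (sumQ a b ha hb z) =
      inner 𝕜 (a x + b y) (z : H) := by
  rw [show sumQ a b ha hb z = WithLp.toLp 2 (EnergySpace.mk a ha ⟨z, z.2.1⟩,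
      EnergySpace.mk b hb ⟨z, z.2.2⟩) from rfl, WithLp.prod_inner_apply, inner_add_left]
  exact congrArg₂ (· + ·) (EnergySpace.inner_mk_mk a ha x ⟨z, z.2.1⟩)
    (EnergySpace.inner_mk_mk b hb y ⟨z, z.2.2⟩)

theorem dense_sumQ_adjoint_domain [CompleteSpace H] (a b : H →ₗ.[𝕜] H)
    (ha : IsPositiveSymmetric a) (hb : IsPositiveSymmetric b) :
    Dense ((sumQ a b ha hb)†.domain : Set (WithLp 2 (EnergySpace a ha × EnergySpace b hb))) := by
  have h1 := (EnergySpace.denseRange_mk a ha).prodMap (EnergySpace.denseRange_mk b hb)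
  have h2 : DenseRange (WithLp.toLp 2 : EnergySpace a ha × EnergySpace b hb → _) :=
    (WithLp.toLp_surjective 2).denseRange
  refine (h2.comp h1 (WithLp.prod_continuous_toLp 2 _ _)).mono ?_
  rintro _ ⟨⟨x, y⟩, rfl⟩
  exact LinearPMap.mem_adjoint_domain_of_exists _
    ⟨a x + b y, fun z => (inner_sumQ_toLp a b ha hb x y z).symm⟩

end SumQ

theorem theorem7 {𝕜 H : Type*} [RCLike 𝕜] [NormedAddCommGroup H] [InnerProductSpace 𝕜 H]
    [CompleteSpace H] (a b : H →ₗ.[𝕜] H)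
    (ha : IsPositiveSymmetric a) (hb : IsPositiveSymmetric b)
    (hdense : Dense ((a.domain ⊓ b.domain : Submodule 𝕜 H) : Set H)) :
    Dense ((sumQ a b ha hb)†.domain :
      Set (WithLp 2 (EnergySpace a ha × EnergySpace b hb))) ∧
    opMul (sumQ a b ha hb)† (sumQ a b ha hb)†† = friedrichsExtension (a + b) (ha.add hb) ∧
    IsLargestPositiveSelfAdjointExtension (a + b)
      (opMul (sumQ a b ha hb)† (sumQ a b ha hb)††) := by
  have hL : ∀ x y : (a + b).domain, inner 𝕜 ((sumQ a b ha hb).toFun x)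
      ((sumQ a b ha hb).toFun y) = inner 𝕜 ((a + b) x) (y : H) := fun x y => by
    rw [LinearPMap.add_apply]
    exact inner_sumQ_toLp a b ha hb ⟨x, x.2.1⟩ ⟨x, x.2.2⟩ y
  have hd := dense_sumQ_adjoint_domain a b ha hb
  exact ⟨hd, opMul_adjoint_eq_friedrichsExtension hL (ha.add hb) hdense hd,
    isLargestPositiveSelfAdjointExtension_opMul_adjoint hL hdense hd⟩
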